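/- All ordered monoids are commutative, with a partial order compatible with addition, and not necessarily positively ordered. In an ordered monoid $S$ write $x\ll y$ if, for every increasing sequence $(z_n)_{n\in\mathbb N}$ in $S$ that has a supremum with $\sup_n z_n\ge y$, there is $k$ with $x\le z_k$. A $\mathrm{Cu}^\sim$-semigroup is an ordered monoid $S$ with $0\ll 0$ such that: (O1) every increasing sequence in $S$ has a supremum; (O2) every element of $S$ is the supremum of a $\ll$-increasing sequence; (O3) $x\ll y$ and $x'\ll y'$ imply $x+x'\ll y+y'$; (O4) $\sup_n(x_n+y_n)=\sup_n x_n+\sup_n y_n$ for all increasing sequences $(x_n)_n,(y_n)_n$. A $\mathrm{Cu}^\sim$-morphism is a map between $\mathrm{Cu}^\sim$-semigroups that preserves $+$, $0$, $\le$, $\ll$ and suprema of increasing sequences. The category $\mathrm{Cu}^*$ is the full subcategory of $\mathrm{Cu}^\sim$ on those $S$ that satisfy (PC) for all $s,t\in S$, if $t\ge 0$ and $s\le t$, then $s+t\ge 0$; (PD) for every $s\in S$ there is $p\in S$ with $s+p\ge 0$; (S0) for all $s,t\in S$, $s+t=0$ implies $s=t=0$. Let $I$ be a nonempty directed set and let $(S_i,\sigma_{ij})_{i\in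 I}$ be an inductive system in $\mathrm{Cu}^*$. Then: 1. The system has an inductive limit in $\mathrm{Cu}^\sim$. If $(S,\sigma_{i\infty})_{i\in I}$ is any such limit, then $S$ satisfies (PC), (PD) and (S0), so that $S$ is a $\mathrm{Cu}^*$-semigroup and the $\sigma_{i\infty}$ are $\mathrm{Cu}^*$-morphisms; moreover $(S,\sigma_{i\infty})_i$ is the inductive limit of the system in $\mathrm{Cu}^*$. 2. Consequently the system has an inductive limit in $\mathrm{Cu}^*$, and a cocone $(S,\sigma_{i\infty})_{i\in I}$ of the system in $\mathrm{Cu}^*$ is an inductive limit of it in $\mathrm{Cu}^*$ if and only if both of the following hold: (L1) for all $s',s\in S$ with $s'\ll s$ there are $i\in I$ and $s_i\in S_i$ with $s'\ll\sigma_{i\infty}(s_i)\ll s$; (L2) for all $i\in I$ and $s,t,s'\in S_i$ with $\sigma_{i\infty}(s)\le\sigma_{i\infty}(t)$ and $s'\ll s$, there is $j\ge i$ with $\sigma_{ij}(s')\ll\sigma_{ij}(t)$. -/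

import Mathlib

open CategoryTheory CategoryTheory.Limits

universe w u

/-- The (sequential) way-below, or compact-containment, relation `x ≪ y`. -/
def WayBelow {S : Type*} [Preorder S] (x y : S) : Prop :=
  ∀ z : ℕ → S, Monotone z → ∀ b : S, IsLUB (Set.range z) b → y ≤ b → ∃ k, x ≤ z k

/-- Axioms of a `Cu^∼`-semigroup, for a (commutative, not necessarily positively) ordered
monoid: (O1)-(O4) and compactness of the neutral element. -/
class IsCuTilde (S : Type*) [AddCommMonoid S] [PartialOrder S] [IsOrderedAddMonoid S] :
    Prop where
  /-- (O1) Every increasing sequence has a supremum. -/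
  exists_isLUB : ∀ z : ℕ → S, Monotone z → ∃ b, IsLUB (Set.range z) b
  /-- (O2) Every element is the supremum of a `≪`-increasing sequence. -/
  exists_wayBelow_seq : ∀ x : S, ∃ z : ℕ → S,
    (∀ n, WayBelow (z n) (z (n + 1))) ∧ IsLUB (Set.range z) x
  /-- (O3) Addition is compatible with `≪`. -/
  add_wayBelow_add : ∀ x y x' y' : S, WayBelow x y → WayBelow x' y' → WayBelow (x + x') (y + y')
  /-- (O4) Addition is compatible with suprema of increasing sequences. -/
  isLUB_add : ∀ (z z' : ℕ → S), Monotone z → Monotone z' → ∀ b b' : S,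
    IsLUB (Set.range z) b → IsLUB (Set.range z') b' →
      IsLUB (Set.range fun n => z n + z' n) (b + b')
  /-- The neutral element is compact. -/
  zero_wayBelow_zero : WayBelow (0 : S) 0

/-- Axiom (PC): `S` is positively convex. -/
def AxiomPC (S : Type*) [AddCommMonoid S] [PartialOrder S] : Prop :=
  ∀ s t : S, 0 ≤ t → s ≤ t → 0 ≤ s + t

/-- Axiom (PD): `S` is positively directed. -/
def AxiomPD (S : Type*) [AddCommMonoid S] [PartialOrder S] : Prop :=
  ∀ s : S, ∃ p : S, 0 ≤ s + p

/-- Axiom (S0): `S` is singular at the origin. -/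
def AxiomS0 (S : Type*) [AddCommMonoid S] : Prop :=
  ∀ s t : S, s + t = 0 → s = 0 ∧ t = 0

/-- Ordered monoid morphisms preserving `≪` and suprema of increasing sequences. -/
structure CuHom (S T : Type*) [AddCommMonoid S] [PartialOrder S] [AddCommMonoid T]
    [PartialOrder T] extends S →+o T where
  map_wayBelow' : ∀ x y : S, WayBelow x y → WayBelow (toFun x) (toFun y)
  map_isLUB' : ∀ z : ℕ → S, Monotone z → ∀ b : S, IsLUB (Set.range z) b →
    IsLUB (Set.range fun n => toFun (z n)) (toFun b)

namespace CuHom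

variable {S T U : Type*} [AddCommMonoid S] [PartialOrder S] [AddCommMonoid T] [PartialOrder T]
  [AddCommMonoid U] [PartialOrder U]

instance : FunLike (CuHom S T) S T where
  coe f := f.toFun
  coe_injective := by
    rintro ⟨f, _, _⟩ ⟨g, _, _⟩ h
    congr
    exact DFunLike.coe_injective h

/-- The identity morphism. -/
def id (S : Type*) [AddCommMonoid S] [PartialOrder S] : CuHom S S where
  toOrderAddMonoidHom := OrderAddMonoidHom.id S
  map_wayBelow' _ _ h := h
  map_isLUB' _ _ _ h := h

/-- Composition of morphisms. -/
def comp (g : CuHom T U) (f : CuHom S T) : CuHom S U where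
  toOrderAddMonoidHom := g.toOrderAddMonoidHom.comp f.toOrderAddMonoidHom
  map_wayBelow' _ _ h := g.map_wayBelow' _ _ (f.map_wayBelow' _ _ h)
  map_isLUB' z hz b hb :=
    g.map_isLUB' (fun n => f.toFun (z n)) (fun _ _ h => f.monotone' (hz h)) _
      (f.map_isLUB' z hz b hb)

end CuHom

/-- The objects of the category `Cu^∼`: `Cu^∼`-semigroups. -/
structure CuTilde : Type (u + 1) where
  /-- The underlying set. -/
  carrier : Type u
  [addCommMonoid : AddCommMonoid carrier]
  [partialOrder : PartialOrder carrier]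
  [isOrderedAddMonoid : IsOrderedAddMonoid carrier]
  [isCuTilde : IsCuTilde carrier]

attribute [instance] CuTilde.addCommMonoid CuTilde.partialOrder CuTilde.isOrderedAddMonoid
  CuTilde.isCuTilde

instance : CoeSort CuTilde.{u} (Type u) := ⟨CuTilde.carrier⟩

instance : Category CuTilde.{u} where
  Hom S T := CuHom S T
  id S := CuHom.id S
  comp f g := g.comp f

instance : ConcreteCategory CuTilde.{u} (fun S T => CuHom S T) where
  hom f := f
  ofHom f := f

/-- The property of a `Cu^∼`-semigroup of being a `Cu^*`-semigroup: (PC), (PD) and (S0). -/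
def isCuStar : ObjectProperty CuTilde.{u} :=
  fun S => AxiomPC S ∧ AxiomPD S ∧ AxiomS0 S

/-- The category `Cu^*`, the full subcategory of `Cu^∼` on the `Cu^*`-semigroups. -/
abbrev CuStar : Type (u + 1) := isCuStar.{u}.FullSubcategory

/-- The inclusion of `Cu^*` in `Cu^∼`. -/
abbrev CuStar.incl : CuStar.{u} ⥤ CuTilde.{u} := isCuStar.{u}.ι

/-- Axiom (L1) for a cocone `(S, σ_{i∞})` in `Cu^*`. -/
def AxiomL1 {I : Type w} [Preorder I] {F : I ⥤ CuStar.{u}} (c : Cocone F) : Prop :=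
  ∀ s' s : c.pt.obj, WayBelow s' s →
    ∃ (i : I) (x : (F.obj i).obj),
      WayBelow s' ((c.ι.app i).hom x) ∧ WayBelow ((c.ι.app i).hom x) s

/-- Axiom (L2) for a cocone `(S, σ_{i∞})` in `Cu^*`. -/
def AxiomL2 {I : Type w} [Preorder I] {F : I ⥤ CuStar.{u}} (c : Cocone F) : Prop :=
  ∀ (i : I) (s t s' : (F.obj i).obj), (c.ι.app i).hom s ≤ (c.ι.app i).hom t → WayBelow s' s →
    ∃ (j : I) (hij : i ≤ j),
      WayBelow ((F.map (homOfLE hij)).hom s') ((F.map (homOfLE hij)).hom t)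

/-!
Inductive limits in `Cu^∼` are characterised by (L1) and (L2), and a limit with these two properties
can be written down explicitly; the axioms (PC), (PD) and (S0) then pass to it from the members of
the system.

*Sufficiency of (L1) and (L2).* Let `g i : G i → S` be a compatible family with (L1) and (L2), and
let `k i : G i → T` be another compatible family. By (L1) every `s` in `S` is the supremum of a
`≪`-increasing sequence of elements `g i x`, so that the only candidate for a factorisation sends `s`
to the supremum of the `k i x` with `g i x ≪ s`. By (L2), `g i x ≤ g i y` implies `k i x' ≤ k i y`
for all `x' ≪ x`, hence `k i x ≤ k i y`. This makes the candidate a well-defined morphism; see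
`CuHom.exists_lift`, applied to the algebraic direct limit, and `CuSystem.existsUnique_hom`.

*Existence.* On the algebraic direct limit `W` of the monoids, let `x ≺ y` if there are
representatives `a ≪ b` at a common index. The countably generated round ideals of `(W, ≺)`, ordered
by inclusion, form a `Cu^∼`-semigroup `RoundIdeal`, in which suprema are unions and `A ≪ B` holds when
`A` is bounded by an element of `B`. The maps sending `x` to the ideal of all `v ≺ x` satisfy (L1) and
(L2): `CuSystem.L1_toCompletion`, `CuSystem.L2_toCompletion`. As both conditions are invariant under
isomorphism, every limit in `Cu^∼` has them (`CuTilde.isColimit_iff`).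

*The axioms of `Cu^*`.* By (L1) elements of the limit are approximated by elements of the members of
the system, and by (L2) inequalities between such approximations hold at a finite stage, where the
axioms are available: `CuSystem.axiomPD`, `CuSystem.axiomPC`, `CuSystem.axiomS0`. Hence limits in
`Cu^∼` of systems in the full subcategory `Cu^*` belong to it, and the limits in the two categories
are the same.
-/

/-! ### The compact-containment relation -/

namespace WayBelow

variable {S : Type*} [PartialOrder S] {x y z : S}

lemma le (h : WayBelow x y) : x ≤ y := by
  obtain ⟨_, hk⟩ := h (fun _ => y) monotone_const y (by simp) le_rfl
  exact hk

lemma trans_le (h : WayBelow x y) (h' : y ≤ z) : WayBelow x z :=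
  fun u hu b hb hzb => h u hu b hb (h'.trans hzb)

lemma le_trans (h : x ≤ y) (h' : WayBelow y z) : WayBelow x z := fun u hu b hb hzb =>
  let ⟨k, hk⟩ := h' u hu b hb hzb
  ⟨k, h.trans hk⟩

end WayBelow

namespace IsCuTilde

variable {S : Type*} [AddCommMonoid S] [PartialOrder S] [IsOrderedAddMonoid S] [IsCuTilde S]

/-- A form of (O2): every element is the supremum of a `≪`-increasing sequence that is cofinal,
for `≪`, among the elements compactly contained in it. -/
lemma exists_cofinal_seq (x : S) : ∃ z : ℕ → S, (∀ n, WayBelow (z n) (z (n + 1))) ∧ Monotone z ∧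
    (∀ n, WayBelow (z n) x) ∧ IsLUB (Set.range z) x ∧
    ∀ y, WayBelow y x → ∃ n, WayBelow y (z n) := by
  obtain ⟨z, hz, hx⟩ := exists_wayBelow_seq x
  have hmono : Monotone z := monotone_nat_of_le_succ fun n => (hz n).le
  refine ⟨z, hz, hmono, fun n => (hz n).trans_le (hx.1 ⟨n + 1, rfl⟩), hx, fun y hy => ?_⟩
  obtain ⟨k, hk⟩ := hy z hmono x hx le_rfl
  exact ⟨k + 1, WayBelow.le_trans hk (hz k)⟩

lemma exists_wayBelow (x : S) : ∃ y, WayBelow y x :=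
  let ⟨z, _, _, hz, _⟩ := exists_cofinal_seq x
  ⟨z 0, hz 0⟩

/-- Addition is continuous: an element compactly contained in `a + b` is compactly contained in the
sum of elements compactly contained in `a` and in `b`. -/
lemma exists_wayBelow_add {x a b : S} (h : WayBelow x (a + b)) :
    ∃ a' b', WayBelow a' a ∧ WayBelow b' b ∧ WayBelow x (a' + b') := by
  obtain ⟨u, hu, hum, hua, hlu, _⟩ := exists_cofinal_seq a
  obtain ⟨v, hv, hvm, hvb, hlv, _⟩ := exists_cofinal_seq b
  obtain ⟨k, hk⟩ := h _ (hum.add hvm) _ (isLUB_add u v hum hvm a b hlu hlv) le_rfl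
  exact ⟨u (k + 1), v (k + 1), hua _, hvb _,
    WayBelow.le_trans hk (add_wayBelow_add _ _ _ _ (hu k) (hv k))⟩

end IsCuTilde

/-! ### Morphisms determined on a dense submonoid -/

namespace CuHom

variable {S T : Type*} [AddCommMonoid S] [PartialOrder S] [AddCommMonoid T] [PartialOrder T]

instance : AddMonoidHomClass (CuHom S T) S T where
  map_add f := f.toOrderAddMonoidHom.map_add'
  map_zero f := f.toOrderAddMonoidHom.map_zero'

lemma monotone (f : CuHom S T) : Monotone f := f.monotone'

lemma map_wayBelow (f : CuHom S T) {x y : S} (h : WayBelow x y) : WayBelow (f x) (f y) :=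
  f.map_wayBelow' x y h

lemma map_isLUB (f : CuHom S T) {z : ℕ → S} (hz : Monotone z) {b : S}
    (hb : IsLUB (Set.range z) b) : IsLUB (Set.range fun n => f (z n)) (f b) :=
  f.map_isLUB' z hz b hb

@[ext]
lemma ext {f g : CuHom S T} (h : ∀ x, f x = g x) : f = g := DFunLike.ext f g h

end CuHom

section Lift

variable {W S T : Type*} [AddCommMonoid S] [PartialOrder S] [AddCommMonoid T] [PartialOrder T]
  [IsOrderedAddMonoid S] [IsCuTilde S]

/-- The map `g` has `≪`-dense range: between any `s' ≪ s` there is some `g w`. -/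
def WayBelowDense (g : W → S) : Prop :=
  ∀ s' s : S, WayBelow s' s → ∃ w, WayBelow s' (g w) ∧ WayBelow (g w) s

/-- Over a `≪`-dense family, every element is the supremum of a sequence from the family, which is
`≪`-increasing and cofinal among the elements compactly contained in it. -/
lemma WayBelowDense.exists_seq {g : W → S} (hg : WayBelowDense g) (s : S) :
    ∃ w : ℕ → W, (∀ n, WayBelow (g (w n)) (g (w (n + 1)))) ∧ (∀ n, WayBelow (g (w n)) s) ∧
      IsLUB (Set.range fun n => g (w n)) s ∧ ∀ y, WayBelow y s → ∃ n, WayBelow y (g (w n)) := by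
  obtain ⟨z, hz, hmono, hzs, hlub, hcof⟩ := IsCuTilde.exists_cofinal_seq s
  choose w hw hw' using fun n => hg _ _ (hz n)
  refine ⟨w, fun n => (hw' n).trans_le (hw (n + 1)).le, fun n => (hw' n).trans_le (hzs _).le,
    ⟨Set.forall_mem_range.2 fun n => ((hw' n).trans_le (hzs _).le).le,
      fun b hb => hlub.2 (Set.forall_mem_range.2 fun n => (hw n).le.trans (hb ⟨n, rfl⟩))⟩,
    fun y hy => ?_⟩
  obtain ⟨n, hn⟩ := hcof y hy
  exact ⟨n, hn.trans_le (hw n).le⟩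

/-- A morphism of `Cu^∼`-semigroups is determined on a `≪`-dense family. -/
lemma CuHom.eq_of_eq_on_dense {g : W → S} (hg : WayBelowDense g) {F F' : CuHom S T}
    (h : ∀ w, F (g w) = F' (g w)) : F = F' := by
  ext s
  obtain ⟨w, hw, _, hlub, _⟩ := hg.exists_seq s
  have hm : Monotone fun n => g (w n) := monotone_nat_of_le_succ fun n => (hw n).le
  have h1 := F.map_isLUB hm hlub
  simp only [h] at h1
  exact h1.unique (F'.map_isLUB hm hlub)

variable [AddCommMonoid W] [IsOrderedAddMonoid T] [IsCuTilde T]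

/-- Extension of a homomorphism along a `≪`-dense homomorphism `g : W → S`. The extension sends `s`
to the supremum of the `f w` with `g w ≪ s`; the hypotheses say that `f` respects the relations
which `g` induces on `W`, and that `f w` is the supremum of the `f v` with `g v ≪ g w`. -/
lemma CuHom.exists_lift (g : W →+ S) (hg : WayBelowDense g) (f : W →+ T)
    (hle : ∀ v w, g v ≤ g w → f v ≤ f w)
    (hwb : ∀ v w, WayBelow (g v) (g w) → WayBelow (f v) (f w))
    (hcont : ∀ w t, (∀ v, WayBelow (g v) (g w) → f v ≤ t) → f w ≤ t) :
    ∃ F : CuHom S T, ∀ w, F (g w) = f w := by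
  -- Along any cofinal sequence the values of `f` have the same supremum.
  have key : ∀ (s : S) (w : ℕ → W) (t : T), (∀ n, WayBelow (g (w n)) s) →
      (∀ y, WayBelow y s → ∃ n, WayBelow y (g (w n))) →
      (IsLUB (Set.range fun n => f (w n)) t ↔ IsLUB (f '' {v | WayBelow (g v) s}) t) := by
    intro s w t hws hcof
    refine iff_of_eq (congrArg (fun B => IsLeast B t) (Set.Subset.antisymm ?_ ?_))
    · rintro b hb _ ⟨v, hv, rfl⟩
      obtain ⟨n, hn⟩ := hcof _ hv
      exact (hle _ _ hn.le).trans (hb ⟨n, rfl⟩)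
    · rintro b hb _ ⟨n, rfl⟩
      exact hb ⟨w n, hws n, rfl⟩
  have hmono : ∀ w : ℕ → W, (∀ n, WayBelow (g (w n)) (g (w (n + 1)))) →
      Monotone fun n => f (w n) :=
    fun w hw => monotone_nat_of_le_succ fun n => hle _ _ (hw n).le
  have hex : ∀ s, ∃ t, IsLUB (f '' {v | WayBelow (g v) s}) t := by
    intro s
    obtain ⟨w, hw, hws, _, hcof⟩ := hg.exists_seq s
    obtain ⟨t, ht⟩ := IsCuTilde.exists_isLUB _ (hmono w hw)
    exact ⟨t, (key s w t hws hcof).1 ht⟩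
  choose F hF using hex
  have hFg : ∀ w, F (g w) = f w := fun w => (hF (g w)).unique
    ⟨Set.forall_mem_image.2 fun v hv => hle _ _ (WayBelow.le hv),
      fun t ht => hcont w t fun v hv => ht ⟨v, hv, rfl⟩⟩
  have hFmono : Monotone F := fun s s' h => (hF s).2 <| Set.forall_mem_image.2 fun v hv =>
    (hF s').1 ⟨v, WayBelow.trans_le hv h, rfl⟩
  have hFadd : ∀ s s', F (s + s') = F s + F s' := by
    intro s s'
    obtain ⟨w, hw, hws, hlub, hcof⟩ := hg.exists_seq s
    obtain ⟨w', hw', hws', hlub', hcof'⟩ := hg.exists_seq s'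
    have h := IsCuTilde.isLUB_add _ _ (hmono w hw) (hmono w' hw') _ _
      ((key s w _ hws hcof).2 (hF s)) ((key s' w' _ hws' hcof').2 (hF s'))
    simp only [← map_add] at h
    refine (hF _).unique ((key (s + s') (fun n => w n + w' n) _ (fun n => ?_) fun y hy => ?_).1 h)
    · rw [map_add]
      exact IsCuTilde.add_wayBelow_add _ _ _ _ (hws n) (hws' n)
    · obtain ⟨a, b, ha, hb, hy'⟩ := IsCuTilde.exists_wayBelow_add hy
      obtain ⟨n, hn⟩ := hcof a ha
      obtain ⟨m, hm⟩ := hcof' b hb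
      have h1 : Monotone fun n => g (w n) := monotone_nat_of_le_succ fun n => (hw n).le
      have h2 : Monotone fun n => g (w' n) := monotone_nat_of_le_succ fun n => (hw' n).le
      refine ⟨max n m, hy'.trans_le ?_⟩
      rw [map_add]
      exact add_le_add (hn.le.trans (h1 (le_max_left n m))) (hm.le.trans (h2 (le_max_right n m)))
  refine ⟨{ toFun := F, map_zero' := ?_, map_add' := hFadd, monotone' := hFmono,
            map_wayBelow' := ?_, map_isLUB' := ?_ }, hFg⟩
  · simpa using hFg 0
  · intro x y hxy
    obtain ⟨w, hxw, hwy⟩ := hg x y hxy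
    obtain ⟨v, hwv, hvy⟩ := hg _ _ hwy
    have hx : F x ≤ f w := hFg w ▸ hFmono hxw.le
    have hy : f v ≤ F y := hFg v ▸ hFmono hvy.le
    exact WayBelow.le_trans hx ((hwb _ _ hwv).trans_le hy)
  · intro z hz b hb
    refine ⟨Set.forall_mem_range.2 fun n => hFmono (hb.1 ⟨n, rfl⟩), fun t ht => ?_⟩
    refine (hF b).2 (Set.forall_mem_image.2 fun v hv => ?_)
    obtain ⟨k, hk⟩ := hv z hz b hb le_rfl
    exact (hFg v ▸ hFmono hk).trans (ht ⟨k, rfl⟩)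

end Lift

/-! ### Completion by round ideals -/

/-- A transitive relation `r` on a commutative monoid `W` which has the properties of `≪` that make
the round ideals of `(W, r)` a `Cu^∼`-semigroup: the set below any `w` is generated by an
`r`-increasing sequence, addition is compatible with `r` and continuous, and `0` is compact. -/
class IsCuBasis {W : Type*} [AddCommMonoid W] (r : W → W → Prop) : Prop where
  trans : ∀ {x y z}, r x y → r y z → r x z
  exists_seq : ∀ w, ∃ u : ℕ → W, (∀ n, r (u n) (u (n + 1))) ∧ (∀ n, r (u n) w) ∧
    ∀ v, r v w → ∃ n, r v (u n)
  add : ∀ {x y x' y'}, r x y → r x' y' → r (x + x') (y + y')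
  exists_add : ∀ {v a b}, r v (a + b) → ∃ a' b', r a' a ∧ r b' b ∧ r v (a' + b')
  zero : r 0 0

/-- A countably generated round ideal for `r`: a set which is closed downwards, directed, and has
a countable cofinal subset, all with respect to `r`. -/
structure RoundIdeal {W : Type*} (r : W → W → Prop) where
  /-- The underlying set. -/
  carrier : Set W
  lower : ∀ {v w}, r v w → w ∈ carrier → v ∈ carrier
  directed : ∀ {v w}, v ∈ carrier → w ∈ carrier → ∃ x ∈ carrier, r v x ∧ r w x
  countable : ∃ u : ℕ → W, (∀ n, u n ∈ carrier) ∧ ∀ v ∈ carrier, ∃ n, r v (u n)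

namespace RoundIdeal

variable {W : Type*} {r : W → W → Prop}

instance : SetLike (RoundIdeal r) W where
  coe := carrier
  coe_injective A B h := by cases A; cases B; congr

instance : PartialOrder (RoundIdeal r) := .ofSetLike (RoundIdeal r) W

@[ext]
lemma ext {A B : RoundIdeal r} (h : ∀ w, w ∈ A ↔ w ∈ B) : A = B := SetLike.ext h

lemma exists_rel {A : RoundIdeal r} {w : W} (hw : w ∈ A) : ∃ x ∈ A, r w x :=
  let ⟨x, hx, h, _⟩ := A.directed hw hw
  ⟨x, hx, h⟩

section Sup

variable (A : ℕ → RoundIdeal r) (hA : Monotone A)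

/-- The union of an increasing sequence of round ideals. -/
def iUnion : RoundIdeal r where
  carrier := {w | ∃ n, w ∈ A n}
  lower h := fun ⟨n, hn⟩ => ⟨n, (A n).lower h hn⟩
  directed := by
    rintro v w ⟨n, hn⟩ ⟨m, hm⟩
    obtain ⟨x, hx, h⟩ := (A (max n m)).directed (hA (le_max_left n m) hn)
      (hA (le_max_right n m) hm)
    exact ⟨x, ⟨_, hx⟩, h⟩
  countable := by
    choose u hu hu' using fun n => (A n).countable
    refine ⟨fun k => u k.unpair.1 k.unpair.2, fun k => ⟨_, hu _ _⟩, ?_⟩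
    rintro v ⟨n, hn⟩
    obtain ⟨m, hm⟩ := hu' n v hn
    exact ⟨Nat.pair n m, by simpa using hm⟩

lemma mem_iUnion {w : W} : w ∈ iUnion A hA ↔ ∃ n, w ∈ A n := Iff.rfl

lemma isLUB_iUnion : IsLUB (Set.range A) (iUnion A hA) :=
  ⟨Set.forall_mem_range.2 fun n _ hw => ⟨n, hw⟩, fun _ hB _ ⟨n, hw⟩ => hB ⟨n, rfl⟩ hw⟩

variable {A}

lemma isLUB_iff (hA : Monotone A) {B : RoundIdeal r} :
    IsLUB (Set.range A) B ↔ ∀ w, w ∈ B ↔ ∃ n, w ∈ A n := by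
  constructor
  · intro h w
    rw [h.unique (isLUB_iUnion A hA), mem_iUnion]
  · intro h
    rw [show B = iUnion A hA from ext h]
    exact isLUB_iUnion A hA

end Sup

variable [AddCommMonoid W] [IsCuBasis r]

/-- A round ideal is generated by an `r`-increasing sequence. -/
lemma exists_seq (A : RoundIdeal r) : ∃ u : ℕ → W, (∀ n, r (u n) (u (n + 1))) ∧ (∀ n, u n ∈ A) ∧
    ∀ v ∈ A, ∃ n, r v (u n) := by
  obtain ⟨u, hu, hcof⟩ := A.countable
  -- Each term of the sequence is chosen above the previous one and above the next generator.
  choose f hfA hf hf' using fun v w : A => A.directed v.2 w.2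
  let x : ℕ → A := fun n =>
    Nat.rec ⟨u 0, hu 0⟩ (fun n y => ⟨f y ⟨u n, hu n⟩, hfA y ⟨u n, hu n⟩⟩) n
  refine ⟨fun n => (x n).1, fun n => hf (x n) ⟨u n, hu n⟩, fun n => (x n).2, fun v hv => ?_⟩
  obtain ⟨n, hn⟩ := hcof v hv
  exact ⟨n + 1, IsCuBasis.trans hn (hf' (x n) ⟨u n, hu n⟩)⟩

lemma rel_of_lt {u : ℕ → W} (hu : ∀ n, r (u n) (u (n + 1))) {n m : ℕ} (h : n < m) :
    r (u n) (u m) :=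
  haveI : IsTrans W r := ⟨fun _ _ _ => IsCuBasis.trans⟩
  Nat.rel_of_forall_rel_succ_of_lt r hu h

variable (r) in
/-- The round ideal of all elements below `w`. -/
def principal (w : W) : RoundIdeal r where
  carrier := {v | r v w}
  lower h h' := IsCuBasis.trans h h'
  directed := by
    intro v v' hv hv'
    obtain ⟨u, hu, huw, hcof⟩ := IsCuBasis.exists_seq (r := r) w
    obtain ⟨n, hn⟩ := hcof v hv
    obtain ⟨m, hm⟩ := hcof v' hv'
    exact ⟨u (max n m + 1), huw _, IsCuBasis.trans hn (rel_of_lt hu (by omega)),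
      IsCuBasis.trans hm (rel_of_lt hu (by omega))⟩
  countable :=
    let ⟨u, _, huw, hcof⟩ := IsCuBasis.exists_seq (r := r) w
    ⟨u, huw, hcof⟩

@[simp]
lemma mem_principal {v w : W} : v ∈ principal r w ↔ r v w := Iff.rfl

lemma principal_le {A : RoundIdeal r} {w : W} (hw : w ∈ A) : principal r w ≤ A :=
  fun _ hv => A.lower hv hw

lemma principal_mono {v w : W} (h : r v w) : principal r v ≤ principal r w := principal_le h

instance : Zero (RoundIdeal r) := ⟨principal r 0⟩

lemma mem_zero {w : W} : w ∈ (0 : RoundIdeal r) ↔ r w 0 := Iff.rfl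

instance : Add (RoundIdeal r) where
  add A B :=
    { carrier := {v | ∃ a ∈ A, ∃ b ∈ B, r v (a + b)}
      lower := fun h ⟨a, ha, b, hb, h'⟩ => ⟨a, ha, b, hb, IsCuBasis.trans h h'⟩
      directed := by
        rintro v v' ⟨a, ha, b, hb, h⟩ ⟨a', ha', b', hb', h'⟩
        obtain ⟨x, hx, hax, hax'⟩ := A.directed ha ha'
        obtain ⟨y, hy, hby, hby'⟩ := B.directed hb hb'
        obtain ⟨x', hx', hxx⟩ := exists_rel hx
        obtain ⟨y', hy', hyy⟩ := exists_rel hy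
        exact ⟨x + y, ⟨x', hx', y', hy', IsCuBasis.add hxx hyy⟩,
          IsCuBasis.trans h (IsCuBasis.add hax hby), IsCuBasis.trans h' (IsCuBasis.add hax' hby')⟩
      countable := by
        obtain ⟨u, hu, huA, hcof⟩ := A.exists_seq
        obtain ⟨v, hv, hvB, hcof'⟩ := B.exists_seq
        refine ⟨fun n => u n + v n, fun n => ⟨_, huA (n + 1), _, hvB (n + 1),
          IsCuBasis.add (hu n) (hv n)⟩, ?_⟩
        rintro x ⟨a, ha, b, hb, h⟩
        obtain ⟨n, hn⟩ := hcof a ha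
        obtain ⟨m, hm⟩ := hcof' b hb
        exact ⟨max n m + 1, IsCuBasis.trans h (IsCuBasis.add
          (IsCuBasis.trans hn (rel_of_lt hu (by omega)))
          (IsCuBasis.trans hm (rel_of_lt hv (by omega))))⟩ }

lemma mem_add {A B : RoundIdeal r} {v : W} : v ∈ A + B ↔ ∃ a ∈ A, ∃ b ∈ B, r v (a + b) := Iff.rfl

lemma add_mem {A B : RoundIdeal r} {a b : W} (ha : a ∈ A) (hb : b ∈ B) : a + b ∈ A + B :=
  let ⟨a', ha', h⟩ := exists_rel ha
  let ⟨b', hb', h'⟩ := exists_rel hb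
  ⟨a', ha', b', hb', IsCuBasis.add h h'⟩

lemma principal_add (a b : W) : principal r (a + b) = principal r a + principal r b := by
  ext v
  constructor
  · intro h
    obtain ⟨a', b', ha, hb, h'⟩ := IsCuBasis.exists_add (mem_principal.1 h)
    exact ⟨a', ha, b', hb, h'⟩
  · rintro ⟨a', ha, b', hb, h⟩
    exact IsCuBasis.trans h (IsCuBasis.add ha hb)

protected lemma add_comm (A B : RoundIdeal r) : A + B = B + A := by
  ext v
  simp only [mem_add]
  exact ⟨fun ⟨a, ha, b, hb, h⟩ => ⟨b, hb, a, ha, add_comm a b ▸ h⟩,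
    fun ⟨a, ha, b, hb, h⟩ => ⟨b, hb, a, ha, add_comm a b ▸ h⟩⟩

protected lemma add_zero (A : RoundIdeal r) : A + 0 = A := by
  ext v
  constructor
  · rintro ⟨a, ha, z, hz, h⟩
    obtain ⟨a', ha', haa⟩ := exists_rel ha
    have h' := IsCuBasis.add haa (mem_zero.1 hz)
    rw [add_zero] at h'
    exact A.lower (IsCuBasis.trans h h') ha'
  · intro hv
    obtain ⟨a, ha, h⟩ := exists_rel hv
    exact ⟨a, ha, 0, IsCuBasis.zero, by rwa [add_zero]⟩

lemma mem_add_add {A B C : RoundIdeal r} {v : W} :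
    v ∈ A + B + C ↔ ∃ a ∈ A, ∃ b ∈ B, ∃ c ∈ C, r v (a + b + c) := by
  constructor
  · rintro ⟨x, ⟨a, ha, b, hb, hx⟩, c, hc, h⟩
    obtain ⟨c', hc', hcc⟩ := exists_rel hc
    exact ⟨a, ha, b, hb, c', hc', IsCuBasis.trans h (IsCuBasis.add hx hcc)⟩
  · rintro ⟨a, ha, b, hb, c, hc, h⟩
    exact ⟨a + b, add_mem ha hb, c, hc, h⟩

protected lemma add_assoc (A B C : RoundIdeal r) : A + B + C = A + (B + C) := by
  rw [RoundIdeal.add_comm A (B + C)]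
  ext v
  simp only [mem_add_add]
  exact ⟨fun ⟨a, ha, b, hb, c, hc, h⟩ => ⟨b, hb, c, hc, a, ha, by
      rwa [show b + c + a = a + b + c by abel]⟩,
    fun ⟨b, hb, c, hc, a, ha, h⟩ => ⟨a, ha, b, hb, c, hc, by
      rwa [show a + b + c = b + c + a by abel]⟩⟩

instance : AddCommMonoid (RoundIdeal r) where
  add_assoc := RoundIdeal.add_assoc
  zero_add A := by rw [RoundIdeal.add_comm, RoundIdeal.add_zero]
  add_zero := RoundIdeal.add_zero
  add_comm := RoundIdeal.add_comm
  nsmul := nsmulRec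

protected lemma add_le_add {A B A' B' : RoundIdeal r} (h : A ≤ B) (h' : A' ≤ B') :
    A + A' ≤ B + B' :=
  fun _ ⟨a, ha, b, hb, hv⟩ => ⟨a, h ha, b, h' hb, hv⟩

instance : IsOrderedAddMonoid (RoundIdeal r) where
  add_le_add_left _ _ h _ := RoundIdeal.add_le_add h le_rfl

lemma exists_isLUB_principal (A : RoundIdeal r) : ∃ u : ℕ → W, (∀ n, r (u n) (u (n + 1))) ∧
    (∀ n, u n ∈ A) ∧ IsLUB (Set.range fun n => principal r (u n)) A := by
  obtain ⟨u, hu, huA, hcof⟩ := A.exists_seq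
  exact ⟨u, hu, huA, (isLUB_iff (monotone_nat_of_le_succ fun n => principal_mono (hu n))).2
    fun w => ⟨hcof w, fun ⟨n, hn⟩ => A.lower hn (huA n)⟩⟩

/-- In the completion `A ≪ B` means that `A` is bounded by an element of `B`. -/
lemma wayBelow_iff {A B : RoundIdeal r} : WayBelow A B ↔ ∃ b ∈ B, A ≤ principal r b := by
  constructor
  · intro h
    obtain ⟨u, hu, huB, hlub⟩ := B.exists_isLUB_principal
    obtain ⟨k, hk⟩ := h _ (monotone_nat_of_le_succ fun n => principal_mono (hu n)) B hlub le_rfl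
    exact ⟨u k, huB k, hk⟩
  · rintro ⟨b, hb, hA⟩ z hz C hC hBC
    obtain ⟨k, hk⟩ := ((isLUB_iff hz).1 hC b).1 (hBC hb)
    exact ⟨k, hA.trans (principal_le hk)⟩

lemma principal_wayBelow {A : RoundIdeal r} {w : W} (hw : w ∈ A) : WayBelow (principal r w) A :=
  wayBelow_iff.2 ⟨w, hw, le_rfl⟩

/-- The countably generated round ideals of a basis form a `Cu^∼`-semigroup: suprema of increasing
sequences are unions. -/
instance : IsCuTilde (RoundIdeal r) where
  exists_isLUB z hz := ⟨_, isLUB_iUnion z hz⟩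
  exists_wayBelow_seq A :=
    let ⟨u, hu, _, hlub⟩ := A.exists_isLUB_principal
    ⟨fun n => principal r (u n), fun n => principal_wayBelow (hu n), hlub⟩
  add_wayBelow_add A B A' B' h h' := by
    obtain ⟨b, hb, hA⟩ := wayBelow_iff.1 h
    obtain ⟨b', hb', hA'⟩ := wayBelow_iff.1 h'
    refine wayBelow_iff.2 ⟨b + b', add_mem hb hb', ?_⟩
    rw [principal_add]
    exact RoundIdeal.add_le_add hA hA'
  isLUB_add z z' hz hz' b b' hb hb' := by
    rw [isLUB_iff hz] at hb
    rw [isLUB_iff hz'] at hb'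
    refine (isLUB_iff (hz.add hz')).2 fun w => ⟨?_, ?_⟩
    · rintro ⟨x, hx, y, hy, h⟩
      obtain ⟨n, hn⟩ := (hb x).1 hx
      obtain ⟨m, hm⟩ := (hb' y).1 hy
      exact ⟨max n m, x, hz (le_max_left n m) hn, y, hz' (le_max_right n m) hm, h⟩
    · rintro ⟨n, x, hx, y, hy, h⟩
      exact ⟨x, (hb x).2 ⟨n, hx⟩, y, (hb' y).2 ⟨n, hy⟩, h⟩
  zero_wayBelow_zero := principal_wayBelow IsCuBasis.zero

end RoundIdeal

/-! ### The conditions (L1) and (L2) for a compatible family -/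

namespace CuSystem

variable {ι : Type*} {G : ι → Type*} [∀ i, AddCommMonoid (G i)] [∀ i, PartialOrder (G i)]

section Conditions

variable {S : Type*} [AddCommMonoid S] [PartialOrder S]

/-- Condition (L1): the images of the `g i` are `≪`-dense in `S`. -/
def L1 (g : ∀ i, CuHom (G i) S) : Prop :=
  ∀ s' s : S, WayBelow s' s → ∃ (i : ι) (x : G i), WayBelow s' (g i x) ∧ WayBelow (g i x) s

/-- An element of `S` dominates some `g i x`, and a complement of `x` in `G i` gives one in `S`. -/
lemma axiomPD [IsOrderedAddMonoid S] [IsCuTilde S] {g : ∀ i, CuHom (G i) S}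
    (h1 : L1 g) (hG : ∀ i, AxiomPD (G i)) : AxiomPD S := by
  intro s
  obtain ⟨s', hs'⟩ := IsCuTilde.exists_wayBelow s
  obtain ⟨i, x, -, hx⟩ := h1 _ _ hs'
  obtain ⟨p, hp⟩ := hG i x
  refine ⟨g i p, ?_⟩
  calc 0 = g i 0 := (map_zero (g i)).symm
    _ ≤ g i (x + p) := (g i).monotone hp
    _ = g i x + g i p := map_add (g i) x p
    _ ≤ s + g i p := add_le_add_left hx.le _

variable [Preorder ι] (f : ∀ i j, i ≤ j → CuHom (G i) (G j))

/-- Condition (L2): inequalities in `S` between images of elements of `G i` come, up to `≪`, from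
inequalities at a later stage of the system. -/
def L2 (g : ∀ i, CuHom (G i) S) : Prop :=
  ∀ (i : ι) (s t s' : G i), g i s ≤ g i t → WayBelow s' s →
    ∃ (j : ι) (hij : i ≤ j), WayBelow (f i j hij s') (f i j hij t)

variable {f} in
/-- Two instances of (L1) can be realised at a common index. -/
lemma L1.exists_common [IsDirectedOrder ι] {g : ∀ i, CuHom (G i) S} (h1 : L1 g)
    (hg : ∀ i j h x, g j (f i j h x) = g i x)
    {s' s t' t : S} (hs : WayBelow s' s) (ht : WayBelow t' t) :
    ∃ (i : ι) (x y : G i), (WayBelow s' (g i x) ∧ WayBelow (g i x) s) ∧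
      WayBelow t' (g i y) ∧ WayBelow (g i y) t := by
  obtain ⟨i, x, hx⟩ := h1 _ _ hs
  obtain ⟨j, y, hy⟩ := h1 _ _ ht
  obtain ⟨k, hik, hjk⟩ := exists_ge_ge i j
  exact ⟨k, f i k hik x, f j k hjk y, by rwa [hg], by rwa [hg]⟩

end Conditions

/-! ### The algebraic direct limit and its completion -/

variable [Preorder ι] (f : ∀ i j, i ≤ j → CuHom (G i) (G j))

section AlgLimit

variable [DirectedSystem G (f · · ·)] [IsDirectedOrder ι]

/-- The relation induced by `≪` on the algebraic direct limit: two classes are related if they have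
representatives, at a common index, that are related by `≪`. -/
def AlgBelow (x y : DirectLimit G f) : Prop :=
  ∃ (i : ι) (a b : G i), x = ⟦⟨i, a⟩⟧ ∧ y = ⟦⟨i, b⟩⟧ ∧ WayBelow a b

variable {f}

lemma algBelow_mk {i : ι} {a b : G i} :
    AlgBelow f ⟦⟨i, a⟩⟧ ⟦⟨i, b⟩⟧ ↔ ∃ j, ∃ h : i ≤ j, WayBelow (f i j h a) (f i j h b) := by
  constructor
  · rintro ⟨k, a', b', ha, hb, h⟩
    obtain ⟨l, hil, hkl, hl : f i l hil a = f k l hkl a'⟩ := Quotient.exact ha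
    obtain ⟨m, him, hkm, hm : f i m him b = f k m hkm b'⟩ := Quotient.exact hb
    obtain ⟨n, hln, hmn⟩ := exists_ge_ge l m
    refine ⟨n, hil.trans hln, ?_⟩
    rw [← DirectedSystem.map_map' f hil hln, hl, DirectedSystem.map_map' f hkl hln,
      ← DirectedSystem.map_map' f him hmn, hm, DirectedSystem.map_map' f hkm hmn]
    exact (f k n _).map_wayBelow h
  · rintro ⟨j, hij, h⟩
    exact ⟨j, _, _, DirectLimit.eq_of_le _ j hij, DirectLimit.eq_of_le _ j hij, h⟩

lemma AlgBelow.mk {i : ι} {a b : G i} (h : WayBelow a b) : AlgBelow f ⟦⟨i, a⟩⟧ ⟦⟨i, b⟩⟧ :=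
  ⟨i, a, b, rfl, rfl, h⟩

/-- Any `v` below the class of `x : G i` has a representative, at some later index, that is compactly
contained in the image of `x`. -/
lemma algBelow_mk_right {v : DirectLimit G f} {i : ι} {x : G i} : AlgBelow f v ⟦⟨i, x⟩⟧ ↔
    ∃ j, ∃ (h : i ≤ j) (a : G j), v = ⟦⟨j, a⟩⟧ ∧ WayBelow a (f i j h x) := by
  constructor
  · intro h
    obtain ⟨k, a, rfl⟩ := DirectLimit.exists_eq_mk f v
    obtain ⟨m, him, hkm⟩ := exists_ge_ge i k
    rw [DirectLimit.eq_of_le ⟨i, x⟩ m him, DirectLimit.eq_of_le ⟨k, a⟩ m hkm] at h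
    obtain ⟨j, hmj, h⟩ := algBelow_mk.1 h
    dsimp only at h
    rw [DirectedSystem.map_map' f, DirectedSystem.map_map' f] at h
    exact ⟨j, him.trans hmj, _, DirectLimit.eq_of_le _ j _, h⟩
  · rintro ⟨j, hij, a, rfl, h⟩
    exact ⟨j, a, _, rfl, DirectLimit.eq_of_le _ j hij, h⟩

lemma AlgBelow.trans {x y z : DirectLimit G f} (h : AlgBelow f x y) (h' : AlgBelow f y z) :
    AlgBelow f x z := by
  obtain ⟨i, x, y, z, rfl, rfl, rfl⟩ := DirectLimit.exists_eq_mk₃ f x y z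
  obtain ⟨j, hij, h⟩ := algBelow_mk.1 h
  obtain ⟨k, hik, h'⟩ := algBelow_mk.1 h'
  obtain ⟨l, hjl, hkl⟩ := exists_ge_ge j k
  refine algBelow_mk.2 ⟨l, hij.trans hjl, ?_⟩
  have h1 := (f j l hjl).map_wayBelow h
  have h2 := (f k l hkl).map_wayBelow h'
  rw [DirectedSystem.map_map' f, DirectedSystem.map_map' f] at h1 h2
  exact h1.trans_le h2.le

variable [∀ i, IsOrderedAddMonoid (G i)] [∀ i, IsCuTilde (G i)]

lemma AlgBelow.exists_seq (w : DirectLimit G f) : ∃ u : ℕ → DirectLimit G f,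
    (∀ n, AlgBelow f (u n) (u (n + 1))) ∧ (∀ n, AlgBelow f (u n) w) ∧
      ∀ v, AlgBelow f v w → ∃ n, AlgBelow f v (u n) := by
  obtain ⟨i, x, rfl⟩ := DirectLimit.exists_eq_mk f w
  obtain ⟨z, hz, hm, hzx, hlub, -⟩ := IsCuTilde.exists_cofinal_seq x
  refine ⟨fun n => ⟦⟨i, z n⟩⟧, fun n => .mk (hz n), fun n => .mk (hzx n), ?_⟩
  intro v hv
  obtain ⟨j, hij, a, rfl, h⟩ := algBelow_mk_right.1 hv
  obtain ⟨n, hn⟩ := h _ (fun _ _ h => (f i j hij).monotone (hm h)) _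
    ((f i j hij).map_isLUB hm hlub) le_rfl
  exact ⟨n + 1, algBelow_mk_right.2 ⟨j, hij, a, rfl,
    WayBelow.le_trans hn ((f i j hij).map_wayBelow (hz n))⟩⟩

variable [Nonempty ι]

instance : IsCuBasis (AlgBelow f) where
  trans := AlgBelow.trans
  exists_seq := AlgBelow.exists_seq
  add := by
    rintro _ _ _ _ ⟨i, a, b, rfl, rfl, h⟩ ⟨j, a', b', rfl, rfl, h'⟩
    obtain ⟨k, hik, hjk⟩ := exists_ge_ge i j
    rw [DirectLimit.eq_of_le ⟨i, a⟩ k hik, DirectLimit.eq_of_le ⟨i, b⟩ k hik,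
      DirectLimit.eq_of_le ⟨j, a'⟩ k hjk, DirectLimit.eq_of_le ⟨j, b'⟩ k hjk,
      DirectLimit.add_def, DirectLimit.add_def]
    exact .mk (IsCuTilde.add_wayBelow_add _ _ _ _ ((f i k hik).map_wayBelow h)
      ((f j k hjk).map_wayBelow h'))
  exists_add := by
    intro v a b h
    obtain ⟨i, v, a, b, rfl, rfl, rfl⟩ := DirectLimit.exists_eq_mk₃ f v a b
    rw [DirectLimit.add_def] at h
    obtain ⟨j, hij, h⟩ := algBelow_mk.1 h
    rw [map_add] at h
    obtain ⟨a', b', ha, hb, h⟩ := IsCuTilde.exists_wayBelow_add h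
    refine ⟨⟦⟨j, a'⟩⟧, ⟦⟨j, b'⟩⟧, ?_, ?_, ?_⟩
    · exact ⟨j, _, _, rfl, DirectLimit.eq_of_le _ j hij, ha⟩
    · exact ⟨j, _, _, rfl, DirectLimit.eq_of_le _ j hij, hb⟩
    · rw [DirectLimit.add_def]
      exact ⟨j, _, _, DirectLimit.eq_of_le _ j hij, rfl, h⟩
  zero := by
    obtain ⟨i⟩ := ‹Nonempty ι›
    rw [DirectLimit.zero_def i]
    exact .mk IsCuTilde.zero_wayBelow_zero

end AlgLimit

section Completion

variable [DirectedSystem G (f · · ·)] [IsDirectedOrder ι] [Nonempty ι]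
  [∀ i, IsOrderedAddMonoid (G i)] [∀ i, IsCuTilde (G i)]

/-- The canonical morphism from a member of the system to the round ideal completion of its
algebraic direct limit. -/
noncomputable def toCompletion (i : ι) : CuHom (G i) (RoundIdeal (AlgBelow f)) where
  toFun x := RoundIdeal.principal (AlgBelow f) ⟦⟨i, x⟩⟧
  map_zero' := by
    rw [← DirectLimit.zero_def i]
    rfl
  map_add' x y := by rw [← RoundIdeal.principal_add, DirectLimit.add_def]
  monotone' := by
    intro x y hxy v hv
    obtain ⟨j, hij, a, rfl, h⟩ := algBelow_mk_right.1 hv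
    exact algBelow_mk_right.2 ⟨j, hij, a, rfl, h.trans_le ((f i j hij).monotone hxy)⟩
  map_wayBelow' x y h := RoundIdeal.principal_wayBelow (AlgBelow.mk h)
  map_isLUB' := by
    intro z hz b hb
    refine ⟨Set.forall_mem_range.2 fun n v hv => ?_, fun A hA v hv => ?_⟩
    · obtain ⟨j, hij, a, rfl, h⟩ := algBelow_mk_right.1 hv
      exact algBelow_mk_right.2
        ⟨j, hij, a, rfl, h.trans_le ((f i j hij).monotone (hb.1 ⟨n, rfl⟩))⟩
    · obtain ⟨j, hij, a, rfl, h⟩ := algBelow_mk_right.1 hv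
      obtain ⟨u, -, -, hu, -, hcof⟩ := IsCuTilde.exists_cofinal_seq (f i j hij b)
      obtain ⟨m, hm⟩ := hcof a h
      obtain ⟨n, hn⟩ := hu m _ (fun _ _ h => (f i j hij).monotone (hz h)) _
        ((f i j hij).map_isLUB hz hb) le_rfl
      exact hA ⟨n, rfl⟩ (algBelow_mk_right.2 ⟨j, hij, a, rfl, hm.trans_le hn⟩)

lemma toCompletion_map {i j : ι} (h : i ≤ j) (x : G i) :
    toCompletion f j (f i j h x) = toCompletion f i x :=
  congrArg (RoundIdeal.principal (AlgBelow f)) (DirectLimit.mk_apply i j x h)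

/-- The completion satisfies (L1), since every round ideal is directed and its elements are classes
of elements of the system. -/
lemma L1_toCompletion : L1 (toCompletion f) := by
  intro A B h
  obtain ⟨b, hb, hA⟩ := RoundIdeal.wayBelow_iff.1 h
  obtain ⟨c, hc, hbc⟩ := RoundIdeal.exists_rel hb
  obtain ⟨i, x, rfl⟩ := DirectLimit.exists_eq_mk f c
  exact ⟨i, x, RoundIdeal.wayBelow_iff.2 ⟨b, hbc, hA⟩, RoundIdeal.principal_wayBelow hc⟩

lemma L2_toCompletion : L2 f (toCompletion f) :=
  fun _ _ _ _ h h' => algBelow_mk.1 (h (AlgBelow.mk h'))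

end Completion

/-! ### The universal property -/

section Cocone

variable {S : Type*} [AddCommMonoid S] [PartialOrder S]
  {f} [IsDirectedOrder ι]
  [∀ i, IsOrderedAddMonoid (G i)] [∀ i, IsCuTilde (G i)]
  [IsOrderedAddMonoid S] [IsCuTilde S]
  {g : ∀ i, CuHom (G i) S}

/-- The homomorphism from the algebraic direct limit given by a compatible family of morphisms. -/
noncomputable def desc [DirectedSystem G (f · · ·)] [Nonempty ι] {S : Type*}
    [AddCommMonoid S] [PartialOrder S] (g : ∀ i, CuHom (G i) S)
    (hg : ∀ i j h x, g j (f i j h x) = g i x) : DirectLimit G f →+ S where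
  toFun := DirectLimit.lift f (g ·) fun i j h x => (hg i j h x).symm
  map_zero' := DirectLimit.lift_zero (f := f) g _
  map_add' := DirectLimit.lift_add (f := f) g _

/-- A compatible family satisfying (L1) and (L2) has the universal property of the limit. -/
lemma existsUnique_hom [DirectedSystem G (f · · ·)] [Nonempty ι]
    (hg : ∀ i j h x, g j (f i j h x) = g i x) (h1 : L1 g) (h2 : L2 f g) {T : Type*}
    [AddCommMonoid T] [PartialOrder T] [IsOrderedAddMonoid T] [IsCuTilde T] (k : ∀ i, CuHom (G i) T)
    (hk : ∀ i j h x, k j (f i j h x) = k i x) : ∃! F : CuHom S T, ∀ i x, F (g i x) = k i x := by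
  have hdense : WayBelowDense (desc g hg) := fun s' s h =>
    let ⟨i, x, hx⟩ := h1 s' s h
    ⟨⟦⟨i, x⟩⟧, hx⟩
  have hle : ∀ i x y, g i x ≤ g i y → k i x ≤ k i y := by
    intro i x y h
    obtain ⟨z, hz, hm, hzx, hlub, -⟩ := IsCuTilde.exists_cofinal_seq x
    refine ((k i).map_isLUB hm hlub).2 (Set.forall_mem_range.2 fun n => ?_)
    obtain ⟨j, hij, h⟩ := h2 i x y (z n) h (hzx n)
    rw [← hk i j hij, ← hk i j hij y]
    exact (k j).monotone h.le
  have hwb : ∀ i x y, WayBelow (g i x) (g i y) → WayBelow (k i x) (k i y) := by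
    intro i x y h
    obtain ⟨z, -, hm, hzy, hlub, -⟩ := IsCuTilde.exists_cofinal_seq y
    obtain ⟨n, hn⟩ := h _ (fun _ _ h => (g i).monotone (hm h)) _ ((g i).map_isLUB hm hlub) le_rfl
    exact WayBelow.le_trans (hle i _ _ hn) ((k i).map_wayBelow (hzy n))
  obtain ⟨F, hF⟩ := CuHom.exists_lift (desc g hg) hdense (desc k hk)
    (DirectLimit.induction₂ f fun i x y => hle i x y)
    (DirectLimit.induction₂ f fun i x y => hwb i x y) (by
      intro w t
      obtain ⟨i, x, rfl⟩ := DirectLimit.exists_eq_mk f w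
      intro h
      obtain ⟨z, -, hm, hzx, hlub, -⟩ := IsCuTilde.exists_cofinal_seq x
      exact ((k i).map_isLUB hm hlub).2 (Set.forall_mem_range.2 fun n =>
        h ⟦⟨i, z n⟩⟧ ((g i).map_wayBelow (hzx n))))
  refine ⟨F, fun i x => hF ⟦⟨i, x⟩⟧, fun F' hF' => CuHom.eq_of_eq_on_dense hdense ?_⟩
  exact DirectLimit.induction f fun i x => (hF' i x).trans (hF ⟦⟨i, x⟩⟧).symm

/-! ### Inheritance of the axioms of a `Cu^*`-semigroup -/

/-- If `s ≤ t` and `0 ≤ t`, then by (L1) there are `g i x ≪ s` and `g i y ≪ t` with `g i x` and `0`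
below `g i y`. By (L2) the same holds, up to shrinking `x`, in some `G l`, where positive convexity
gives `0 ≤ x + y`. -/
lemma axiomPC [DirectedSystem G (f · · ·)]
    (hg : ∀ i j h x, g j (f i j h x) = g i x) (h1 : L1 g) (h2 : L2 f g)
    (hG : ∀ i, AxiomPC (G i)) : AxiomPC S := by
  intro s t ht hst
  obtain ⟨s₀, hs₀⟩ := IsCuTilde.exists_wayBelow s
  -- Both `0` and some `g i₀ x₀ ≪ s` are compactly contained in `t`, hence in some `g i₁ y₀ ≪ t`.
  obtain ⟨i₀, x₀, -, hx₀s⟩ := h1 _ _ hs₀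
  obtain ⟨z, -, hm, hzt, -, hcof⟩ := IsCuTilde.exists_cofinal_seq t
  obtain ⟨n, hn⟩ := hcof _ (IsCuTilde.zero_wayBelow_zero.trans_le ht)
  obtain ⟨m, hm'⟩ := hcof _ (hx₀s.trans_le hst)
  obtain ⟨i₁, y₀, hy, hyt⟩ := h1 _ _ (hzt (max n m))
  obtain ⟨i, hi₀, hi₁⟩ := exists_ge_ge i₀ i₁
  have hxy : g i (f i₀ i hi₀ x₀) ≤ g i (f i₁ i hi₁ y₀) := by
    rw [hg, hg]
    exact hm'.le.trans ((hm (le_max_right n m)).trans hy.le)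
  have h0y : g i 0 ≤ g i (f i₁ i hi₁ y₀) := by
    rw [hg, map_zero]
    exact hn.le.trans ((hm (le_max_left n m)).trans hy.le)
  rw [← hg i₀ i hi₀] at hx₀s
  rw [← hg i₁ i hi₁] at hyt
  generalize f i₀ i hi₀ x₀ = x at *
  generalize f i₁ i hi₁ y₀ = y at *
  obtain ⟨x', hx'⟩ := IsCuTilde.exists_wayBelow x
  obtain ⟨j, hij, hj⟩ := h2 i _ _ _ hxy hx'
  obtain ⟨k, hik, hk⟩ := h2 i _ _ _ h0y IsCuTilde.zero_wayBelow_zero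
  obtain ⟨l, hjl, hkl⟩ := exists_ge_ge j k
  have hj' := (f j l hjl).monotone hj.le
  have hk' := (f k l hkl).monotone hk.le
  rw [DirectedSystem.map_map' f, DirectedSystem.map_map' f] at hj' hk'
  rw [map_zero] at hk'
  have hpos := (g l).monotone (hG l _ _ hk' hj')
  rw [map_zero, map_add, hg, hg] at hpos
  exact hpos.trans (add_le_add (((g i).monotone hx'.le).trans hx₀s.le) hyt.le)

/-- Since `0 ≪ 0 = s + t`, (L1) and (L2) give elements `x'`, `y'` of some `G k` with images below `s`
and `t` and with `x' + y' = 0`. Both vanish, so that `s` and `t` are nonnegative, and nonnegative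
elements with sum zero are zero. -/
lemma axiomS0 (hg : ∀ i j h x, g j (f i j h x) = g i x)
    (h1 : L1 g) (h2 : L2 f g) (hG : ∀ i, AxiomS0 (G i)) : AxiomS0 S := by
  intro s t hst
  obtain ⟨s', t', hs', ht', h0⟩ :=
    IsCuTilde.exists_wayBelow_add (IsCuTilde.zero_wayBelow_zero.trans_le hst.ge)
  obtain ⟨i, x, y, ⟨hsx, hxs⟩, hty, hyt⟩ := h1.exists_common hg hs' ht'
  -- The element `x + y` becomes nonnegative at a later stage.
  have h0xy : g i 0 ≤ g i (x + y) := by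
    rw [map_zero, map_add]
    exact h0.le.trans (add_le_add hsx.le hty.le)
  obtain ⟨j, hij, hj⟩ := h2 i _ _ _ h0xy IsCuTilde.zero_wayBelow_zero
  rw [map_zero, map_add] at hj
  obtain ⟨x', y', hx', hy', h0'⟩ := IsCuTilde.exists_wayBelow_add hj
  -- The sum of slightly smaller elements is moreover nonpositive at a later stage, thus zero.
  have hxy0 : g j (f i j hij x + f i j hij y) ≤ g j 0 := by
    rw [map_zero, map_add, hg, hg]
    exact (add_le_add hxs.le hyt.le).trans hst.le
  obtain ⟨k, hjk, hk⟩ := h2 j _ _ _ hxy0 (IsCuTilde.add_wayBelow_add _ _ _ _ hx' hy')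
  have hsum : f j k hjk x' + f j k hjk y' = 0 := by
    rw [← map_add]
    refine le_antisymm (hk.le.trans (map_zero (f j k hjk)).le) ?_
    simpa using (f j k hjk).monotone h0'.le
  obtain ⟨hx0, hy0⟩ := hG k _ _ hsum
  have hs : 0 ≤ s := by
    calc 0 = g k (f j k hjk x') := by rw [hx0, map_zero]
      _ = g j x' := hg j k hjk x'
      _ ≤ g j (f i j hij x) := (g j).monotone hx'.le
      _ = g i x := hg i j hij x
      _ ≤ s := hxs.le
  have ht : 0 ≤ t := by
    calc 0 = g k (f j k hjk y') := by rw [hy0, map_zero]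
      _ = g j y' := hg j k hjk y'
      _ ≤ g j (f i j hij y) := (g j).monotone hy'.le
      _ = g i y := hg i j hij y
      _ ≤ t := hyt.le
  exact ⟨le_antisymm (by simpa [hst] using add_le_add_right ht s) hs,
    le_antisymm (by simpa [hst] using add_le_add_left hs t) ht⟩

end Cocone

end CuSystem

/-! ### Inductive limits in `Cu^∼` and `Cu^*` -/

namespace CuTilde

variable {I : Type w} [Preorder I] (G : I ⥤ CuTilde.{u})

/-- The transition morphisms of a functor on a preorder. -/
def trans (i j : I) (h : i ≤ j) : CuHom (G.obj i) (G.obj j) := G.map (homOfLE h)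

instance : DirectedSystem (fun i => (G.obj i : Type u)) (trans G · · ·) where
  map_self i x := congrArg (fun φ : CuHom (G.obj i) (G.obj i) => φ x) (G.map_id i)
  map_map {k _ i} hij hjk x :=
    congrArg (fun φ : CuHom (G.obj i) (G.obj k) => φ x)
      (G.map_comp (homOfLE hij) (homOfLE hjk)).symm

variable {G}

/-- The components of a cocone, as `Cu^∼`-morphisms. -/
def leg (c : Cocone G) (i : I) : CuHom (G.obj i) c.pt := c.ι.app i

lemma leg_trans (c : Cocone G) (i j : I) (h : i ≤ j) (x : G.obj i) :
    leg c j (trans G i j h x) = leg c i x :=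
  congrArg (fun φ : CuHom (G.obj i) c.pt => φ x) (c.w (homOfLE h))

/-- The cocone given by a compatible family of morphisms. -/
def coconeMk (S : CuTilde.{u}) (g : ∀ i, CuHom (G.obj i) S)
    (hg : ∀ i j h x, g j (trans G i j h x) = g i x) : Cocone G where
  pt := S
  ι :=
    { app := g
      naturality := fun i j φ => CuHom.ext fun x => hg i j (leOfHom φ) x }

lemma L1_L2_of_iso {c c' : Cocone G} (e : c ≅ c') (h1 : CuSystem.L1 (leg c))
    (h2 : CuSystem.L2 (trans G) (leg c)) :
    CuSystem.L1 (leg c') ∧ CuSystem.L2 (trans G) (leg c') := by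
  let φ : CuHom c.pt c'.pt := e.hom.hom
  let ψ : CuHom c'.pt c.pt := e.inv.hom
  have hφ : ∀ i x, φ (leg c i x) = leg c' i x := fun i x =>
    congrArg (fun φ : CuHom (G.obj i) c'.pt => φ x) (e.hom.w i)
  have hψ : ∀ i x, ψ (leg c' i x) = leg c i x := fun i x =>
    congrArg (fun φ : CuHom (G.obj i) c.pt => φ x) (e.inv.w i)
  have hφψ : ∀ s, φ (ψ s) = s := fun s =>
    congrArg (fun φ : c' ⟶ c' => (φ.hom : CuHom c'.pt c'.pt) s) e.inv_hom_id
  constructor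
  · intro s' s h
    obtain ⟨i, x, hx, hx'⟩ := h1 _ _ (ψ.map_wayBelow h)
    have hx := φ.map_wayBelow hx
    have hx' := φ.map_wayBelow hx'
    rw [hφ, hφψ] at hx hx'
    exact ⟨i, x, hx, hx'⟩
  · intro i s t s' h hs
    have h := ψ.monotone h
    rw [hψ, hψ] at h
    exact h2 i s t s' h hs

variable [IsDirectedOrder I] [Nonempty I]

lemma isColimit_of_L1_L2 (c : Cocone G) (h1 : CuSystem.L1 (leg c))
    (h2 : CuSystem.L2 (trans G) (leg c)) : Nonempty (IsColimit c) := by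
  have key := fun s : Cocone G =>
    CuSystem.existsUnique_hom (leg_trans c) h1 h2 (leg s) (leg_trans s)
  choose d hd hd' using key
  exact ⟨{  desc := d
            fac := fun s i => CuHom.ext fun x => hd s i x
            uniq := fun s m hm => hd' s m fun i x =>
              congrArg (fun φ : CuHom (G.obj i) s.pt => φ x) (hm i) }⟩

/-- Every directed system in `Cu^∼` has a cocone with (L1) and (L2). -/
lemma exists_cocone_L1_L2 (G : I ⥤ CuTilde.{max w u}) :
    ∃ c : Cocone G, CuSystem.L1 (leg c) ∧ CuSystem.L2 (trans G) (leg c) :=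
  ⟨coconeMk ⟨RoundIdeal (CuSystem.AlgBelow (trans G))⟩ (CuSystem.toCompletion (trans G))
    fun _ _ h x => CuSystem.toCompletion_map (trans G) h x,
    CuSystem.L1_toCompletion (trans G), CuSystem.L2_toCompletion (trans G)⟩

/-- The conditions (L1) and (L2) characterise limits in `Cu^∼`: one limit satisfies them, and they are
invariant under isomorphism. -/
lemma isColimit_iff (G : I ⥤ CuTilde.{max w u}) (c : Cocone G) :
    Nonempty (IsColimit c) ↔ CuSystem.L1 (leg c) ∧ CuSystem.L2 (trans G) (leg c) := by
  refine ⟨fun ⟨h⟩ => ?_, fun h => isColimit_of_L1_L2 c h.1 h.2⟩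
  obtain ⟨c₀, h1, h2⟩ := exists_cocone_L1_L2.{w, u} G
  obtain ⟨h₀⟩ := isColimit_of_L1_L2 c₀ h1 h2
  exact L1_L2_of_iso (h₀.uniqueUpToIso h) h1 h2

end CuTilde

theorem mainTheorem5 {I : Type w} [Preorder I] [IsDirectedOrder I] [Nonempty I]
    (F : I ⥤ CuStar.{max w u}) :
    -- the system has an inductive limit in `Cu^∼`
    HasColimit (F ⋙ CuStar.incl) ∧
    -- any such limit satisfies (PC), (PD), (S0), so that it is (the image of) a cocone in `Cu^*`,
    -- and it is the inductive limit there
    (∀ c : Cocone (F ⋙ CuStar.incl), Nonempty (IsColimit c) →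
      (AxiomPC c.pt ∧ AxiomPD c.pt ∧ AxiomS0 c.pt) ∧
      ∃ c' : Cocone F, CuStar.incl.mapCocone c' = c ∧ Nonempty (IsColimit c')) ∧
    -- the system has an inductive limit in `Cu^*`
    HasColimit F ∧
    -- the inductive limits in `Cu^*` are characterized by (L1) and (L2)
    (∀ c : Cocone F, Nonempty (IsColimit c) ↔ AxiomL1 c ∧ AxiomL2 c) := by
  obtain ⟨c₀, h₀⟩ : ∃ c : Cocone (F ⋙ CuStar.incl), Nonempty (IsColimit c) :=
    let ⟨c, h1, h2⟩ := CuTilde.exists_cocone_L1_L2.{w, u} (F ⋙ CuStar.incl)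
    ⟨c, CuTilde.isColimit_of_L1_L2 c h1 h2⟩
  have main : ∀ c : Cocone (F ⋙ CuStar.incl), Nonempty (IsColimit c) →
      (AxiomPC c.pt ∧ AxiomPD c.pt ∧ AxiomS0 c.pt) ∧
      ∃ c' : Cocone F, CuStar.incl.mapCocone c' = c ∧ Nonempty (IsColimit c') := by
    intro c hc
    obtain ⟨h1, h2⟩ := (CuTilde.isColimit_iff.{w, u} _ c).1 hc
    have hg := CuTilde.leg_trans c
    have hax : AxiomPC c.pt ∧ AxiomPD c.pt ∧ AxiomS0 c.pt :=
      ⟨CuSystem.axiomPC hg h1 h2 fun i => (F.obj i).property.1,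
        CuSystem.axiomPD h1 fun i => (F.obj i).property.2.1,
        CuSystem.axiomS0 hg h1 h2 fun i => (F.obj i).property.2.2⟩
    let c' : Cocone F :=
      { pt := ⟨c.pt, hax⟩
        ι := { app := fun i => ObjectProperty.homMk (c.ι.app i)
               naturality := fun i j φ => ObjectProperty.hom_ext _ (c.ι.naturality φ) } }
    exact ⟨hax, c', rfl, hc.map fun h => isColimitOfReflects CuStar.incl (c := c') h⟩
  obtain ⟨c', rfl, ⟨h'⟩⟩ := (main c₀ h₀).2
  refine ⟨h₀.elim fun h => ⟨⟨_, h⟩⟩, main, ⟨⟨c', h'⟩⟩, fun c => ?_⟩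
  -- Limits in `Cu^*` are limits in `Cu^∼`, since the limit in `Cu^∼` lies in `Cu^*`.
  have hiff : Nonempty (IsColimit c) ↔ Nonempty (IsColimit (CuStar.incl.mapCocone c)) :=
    ⟨fun ⟨h⟩ => h₀.map fun h'' => h''.ofIsoColimit
        ((Cocone.functoriality F CuStar.incl).mapIso (h'.uniqueUpToIso h)),
      fun ⟨h⟩ => ⟨isColimitOfReflects CuStar.incl h⟩⟩
  rw [hiff, CuTilde.isColimit_iff.{w, u}]
  rfl
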